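/- \textbf{Conventions.} A non-commutative probability space is a pair $(\mathcal A,\varphi)$ of a unital complex algebra $\mathcal A$ and a linear functional $\varphi:\mathcal A\to\mathbb C$ with $\varphi(1)=1$. Let $(\mathcal A_i)_{i\in I}$ be a family of (not necessarily unital) subalgebras of $\mathcal A$ indexed by a partially ordered set $(I,\preceq)$; write $i\prec j$ if $i\preceq j$ and $i\ne j$, and $i\nsim j$ if $i$ and $j$ are not comparable. The family is \emph{BM independent} if for all $m\ge 1$, all $i_1,\dots,i_m\in I$ with $i_1\neq i_2,\ i_2\ne i_3,\dots,\ i_{m-1}\neq i_m$ and all $a_k\in\mathcal A_{i_k}$ the following two conditions hold. \begin{itemize} \item[(BM1)] If $2\le k\le m-1$ and $i_{k-1}\prec i_k\succ i_{k+1}$, or $i_{k-1}\nsim i_k\succ i_{k+1}$, or $i_{k-1}\prec i_k\nsim i_{k+1}$, then, as elements of $\mathcal A$, $$a_1\cdots a_m=\varphi(a_k)\,a_1\cdots a_{k-1}a_{k+1}\cdots a_m .$$ \item[(BM2)] If $i_1\succ\cdots\succ i_k\nsim\cdots\nsim i_{k+\ell}\prec\cdots\prec i_m$ for some $1\le k\le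 m$ and $0\le\ell\le m-k$ (relations between consecutive indices), then $\varphi(a_1\cdots a_m)=\prod_{j=1}^m\varphi(a_j)$. \end{itemize} \textbf{Theorem.} Let $H_1,\dots,H_N$ be complex Hilbert spaces with unit vectors $\xi_i\in H_i$, let $P_i(x)=\langle x,\xi_i\rangle\xi_i$ be the projection onto $\mathbb C\xi_i$ and $I_i$ the identity of $H_i$. Let $H=H_1\otimes\cdots\otimes H_N$ be the Hilbert space tensor product, $\xi=\xi_1\otimes\cdots\otimes\xi_N$, and $\varphi(T)=\langle T\xi,\xi\rangle$ for $T\in B(H)$. Let $\preceq$ be a partial order on $[N]=\{1,\dots,N\}$ and let $G=([N],E)$ be its digraph, $E=\{(i,j): j\prec i\}$. For $A\in B(H_i)$ put $$\pi_i(A)=P_{i,1}\otimes\cdots\otimes P_{i,i-1}\otimes A\otimes P_{i,i+1}\otimes\cdots\otimes P_{i,N},\qquad P_{i,j}=\begin{cases}I_j,&(i,j)\in E,\\ P_j,&(i,j)\notin E.\end{cases}$$ Then the family of $*$-subalgebras $\{\pi_i(B(H_i))\}_{i=1}^N$ of $(B(H),\varphi)$, indexed by $([N],\preceq)$, is BM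 independent. -/

import Mathlib

noncomputable section

/-! ## Non-commutative probability spaces and BM independence -/

/-- The functional of a non-commutative probability space `(A, φ)`: a linear functional on the
unital complex algebra `A` with `φ 1 = 1`. -/
structure NCState (A : Type*) [Ring A] [Algebra ℂ A] extends A →ₗ[ℂ] ℂ where
  map_one' : toFun 1 = 1

instance (A : Type*) [Ring A] [Algebra ℂ A] : CoeFun (NCState A) (fun _ => A → ℂ) :=
  ⟨fun φ => φ.toLinearMap⟩

/-- `i` and `j` are not comparable in the partial order. -/
def Incomp {ι : Type*} [PartialOrder ι] (i j : ι) : Prop := ¬ i ≤ j ∧ ¬ j ≤ i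

section BM

variable {ι : Type*} [PartialOrder ι] {A : Type*} [Ring A] [Algebra ℂ A]

/-- Condition BM1 for one word `a₁ ⋯ aₘ` with `aₖ` in the `iₖ`-th algebra: if `p, k, q` are
consecutive positions and the middle index dominates in the sense below, then the letter at
position `k` may be replaced, inside the algebra, by the scalar `φ (a k)`. -/
def BM1 (φ : NCState A) {m : ℕ} (i : Fin m → ι) (a : Fin m → A) : Prop :=
  ∀ p k q : Fin m, (p : ℕ) + 1 = k → (k : ℕ) + 1 = q →
    ((i p < i k ∧ i q < i k) ∨ (Incomp (i p) (i k) ∧ i q < i k) ∨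
      (i p < i k ∧ Incomp (i k) (i q))) →
    (List.ofFn a).prod = φ (a k) • ((List.ofFn a).eraseIdx k).prod

/-- Condition BM2 for one word: if there are positions `k ≤ l` such that the indices strictly
decrease up to position `k`, consecutive ones are incomparable between `k` and `l`, and they
strictly increase from `l` on, then `φ` factorizes completely. -/
def BM2 (φ : NCState A) {m : ℕ} (i : Fin m → ι) (a : Fin m → A) : Prop :=
  ∀ k l : Fin m, k ≤ l →
    (∀ p q : Fin m, (p : ℕ) + 1 = q → q ≤ k → i q < i p) →
    (∀ p q : Fin m, (p : ℕ) + 1 = q → k ≤ p → q ≤ l → Incomp (i p) (i q)) →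
    (∀ p q : Fin m, (p : ℕ) + 1 = q → l ≤ p → i p < i q) →
    φ (List.ofFn a).prod = ∏ j, φ (a j)

/-- The family `S` of (not necessarily unital) subalgebras of the non-commutative probability space
`(A, φ)`, indexed by a partially ordered set, is BM independent: every alternating product
of elements of the family satisfies BM1 and BM2. -/
def BMIndependent (φ : NCState A) (S : ι → NonUnitalSubalgebra ℂ A) : Prop :=
  ∀ (m : ℕ) (i : Fin m → ι) (a : Fin m → A),
    (∀ k, a k ∈ S (i k)) →
    (∀ p q : Fin m, (p : ℕ) + 1 = q → i p ≠ i q) →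
    BM1 φ i a ∧ BM2 φ i a

end BM

/-- The digraph of a partial order: `(i, j)` is an edge iff `j` is strictly below `i`. -/
def orderDigraph (ι : Type*) [PartialOrder ι] : Digraph ι where
  Adj i j := j < i

/-- The vector state `T ↦ ⟨T ξ, ξ⟩` (the inner product being linear in the argument `T ξ`). -/
def vectorState {K : Type*} [NormedAddCommGroup K] [InnerProductSpace ℂ K] (ξ : K)
    (hξ : ‖ξ‖ = 1) : NCState (K →L[ℂ] K) where
  toFun T := inner ℂ ξ (T ξ)
  map_add' := by intros; simp
  map_smul' := by intros; simp
  map_one' := by simp [inner_self_eq_norm_sq_to_K, hξ]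

/-- The rank one projection `x ↦ ⟨x, ξ⟩ ξ` (the inner product being linear in `x`). -/
def projOnto {K : Type*} [NormedAddCommGroup K] [InnerProductSpace ℂ K] (ξ : K) : K →L[ℂ] K :=
  (innerSL ℂ ξ).smulRight ξ

/-! ## The Hilbert space tensor product of a finite family -/

section Tensor

variable {ι : Type*} [Fintype ι] (H : ι → Type*) [∀ i, NormedAddCommGroup (H i)]
  [∀ i, InnerProductSpace ℂ (H i)]

/-- The algebraic tensor product of the `H i`, to be given the inner product with
`⟪⊗ xᵢ, ⊗ yᵢ⟫ = ∏ ⟪xᵢ, yᵢ⟫`. -/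
def AlgTensor : Type _ := PiTensorProduct ℂ H

instance : AddCommGroup (AlgTensor H) := inferInstanceAs (AddCommGroup (PiTensorProduct ℂ H))
instance : Module ℂ (AlgTensor H) := inferInstanceAs (Module ℂ (PiTensorProduct ℂ H))

namespace AlgTensor

open scoped ComplexOrder

variable {H}

/-- The elementary tensors. -/
def tprod : MultilinearMap ℂ H (AlgTensor H) := PiTensorProduct.tprod ℂ

/-- The linear functional on the algebraic tensor product given by a multilinear form. -/
def lift (M : MultilinearMap ℂ H ℂ) : AlgTensor H →ₗ[ℂ] ℂ := PiTensorProduct.lift M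

lemma lift_tprod (M : MultilinearMap ℂ H ℂ) (x : ∀ i, H i) : lift M (tprod x) = M x :=
  PiTensorProduct.lift.tprod x

/-- The linear functional `⊗ yᵢ ↦ ∏ ⟪xᵢ, yᵢ⟫`. -/
def functional (x : ∀ i, H i) : AlgTensor H →ₗ[ℂ] ℂ :=
  lift
    ((MultilinearMap.mkPiAlgebra ℂ ι ℂ).compLinearMap fun i => (innerSL ℂ (x i)).toLinearMap)

lemma functional_tprod (x y : ∀ i, H i) :
    functional x (tprod y) = ∏ i, inner ℂ (x i) (y i) := by
  simp [functional, lift_tprod]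

lemma span_tprod : Submodule.span ℂ (Set.range (tprod (H := H))) = ⊤ :=
  PiTensorProduct.span_tprod_eq_top

lemma exists_rep (x : AlgTensor H) :
    ∃ (n : ℕ) (c : Fin n → ℂ) (v : Fin n → ∀ i, H i), x = ∑ a, c a • tprod (v a) := by
  have hx : x ∈ Submodule.span ℂ (Set.range (tprod (H := H))) := by
    rw [span_tprod]; trivial
  obtain ⟨n, c, g, hg⟩ := Submodule.mem_span_set'.1 hx
  choose v hv using fun a => (g a).2
  exact ⟨n, c, v, by rw [← hg]; simp [hv]⟩

lemma ext_tprod {E : Type*} [AddCommGroup E] [Module ℂ E] {f g : AlgTensor H →ₗ[ℂ] E}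
    (h : ∀ x, f (tprod x) = g (tprod x)) : f = g :=
  LinearMap.ext_on_range span_tprod h

/-- The multilinear form `x ↦ conj ⟪⊗ xᵢ, y⟫`. -/
def conjForm (y : AlgTensor H) : MultilinearMap ℂ H ℂ where
  toFun x := starRingEnd ℂ (functional x y)
  map_update_add' := by
    intro _ x i u v
    have : functional (Function.update x i (u + v)) =
        functional (Function.update x i u) + functional (Function.update x i v) := by
      apply ext_tprod
      intro y
      simp only [LinearMap.add_apply, functional_tprod]
      rw [Fintype.prod_eq_mul_prod_compl i, Fintype.prod_eq_mul_prod_compl i,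
        Fintype.prod_eq_mul_prod_compl i]
      have h : ∀ w, ∏ j ∈ {i}ᶜ, inner ℂ (Function.update x i w j) (y j) =
          ∏ j ∈ {i}ᶜ, inner ℂ (x j) (y j) := fun w =>
        Finset.prod_congr rfl fun j hj => by
          rw [Function.update_of_ne (by simpa using hj)]
      simp [h, add_mul]
    rw [this]; simp
  map_update_smul' := by
    intro _ x i c u
    have : functional (Function.update x i (c • u)) =
        (starRingEnd ℂ c) • functional (Function.update x i u) := by
      apply ext_tprod
      intro y
      simp only [LinearMap.smul_apply, functional_tprod]
      rw [Fintype.prod_eq_mul_prod_compl i, Fintype.prod_eq_mul_prod_compl i]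
      have h : ∀ w, ∏ j ∈ {i}ᶜ, inner ℂ (Function.update x i w j) (y j) =
          ∏ j ∈ {i}ᶜ, inner ℂ (x j) (y j) := fun w =>
        Finset.prod_congr rfl fun j hj => by
          rw [Function.update_of_ne (by simpa using hj)]
      simp [h]; ring
    rw [this]; simp

/-- The sesquilinear form on the algebraic tensor product. -/
def form (x y : AlgTensor H) : ℂ :=
  starRingEnd ℂ (lift (conjForm y) x)

lemma form_add_left (x y z : AlgTensor H) : form (x + y) z = form x z + form y z := by
  unfold form
  rw [map_add, map_add]

lemma form_smul_left (c : ℂ) (x z : AlgTensor H) :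
    form (c • x) z = starRingEnd ℂ c * form x z := by
  unfold form
  rw [map_smul, smul_eq_mul, map_mul]

lemma form_tprod_left (x : ∀ i, H i) (y : AlgTensor H) : form (tprod x) y = functional x y := by
  unfold form
  rw [lift_tprod]
  exact Complex.conj_conj _

lemma form_sum_left {n : ℕ} (c : Fin n → ℂ) (v : Fin n → AlgTensor H) (y : AlgTensor H) :
    form (∑ a, c a • v a) y = ∑ a, starRingEnd ℂ (c a) * form (v a) y := by
  let f : AlgTensor H →+ ℂ := AddMonoidHom.mk' (fun x => form x y) fun _ _ => form_add_left _ _ _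
  calc form (∑ a, c a • v a) y = f (∑ a, c a • v a) := rfl
    _ = ∑ a, f (c a • v a) := map_sum _ _ _
    _ = _ := Finset.sum_congr rfl fun a _ => form_smul_left _ _ _

lemma form_rep {n n' : ℕ} (c : Fin n → ℂ) (v : Fin n → ∀ i, H i)
    (d : Fin n' → ℂ) (w : Fin n' → ∀ i, H i) :
    form (∑ a, c a • tprod (v a)) (∑ b, d b • tprod (w b)) =
      ∑ a, ∑ b, starRingEnd ℂ (c a) * (d b * ∏ i, inner ℂ (v a i) (w b i)) := by
  rw [form_sum_left]
  refine Finset.sum_congr rfl fun a _ => ?_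
  rw [form_tprod_left, map_sum, Finset.mul_sum]
  simp [functional_tprod]

open Matrix in
lemma form_rep_self {n : ℕ} (c : Fin n → ℂ) (v : Fin n → ∀ i, H i) :
    form (∑ a, c a • tprod (v a)) (∑ b, c b • tprod (v b)) =
      star c ⬝ᵥ ((Matrix.of fun a b => ∏ i, Matrix.gram ℂ (fun a => v a i) a b) *ᵥ c) := by
  rw [form_rep]
  simp only [dotProduct, mulVec, Finset.mul_sum, Matrix.of_apply, Matrix.gram_apply, Pi.star_apply]
  refine Finset.sum_congr rfl fun a _ => Finset.sum_congr rfl fun b _ => ?_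
  rw [mul_comm (c b)]; rfl

lemma posSemidef_prod {n : ℕ} (M : ι → Matrix (Fin n) (Fin n) ℂ) (hM : ∀ i, (M i).PosSemidef)
    (s : Finset ι) : (Matrix.of fun a b => ∏ i ∈ s, M i a b).PosSemidef := by
  classical
  induction s using Finset.induction_on with
  | empty =>
    have : (Matrix.of fun a b : Fin n => ∏ i ∈ (∅ : Finset ι), M i a b) =
        Matrix.gram ℂ (fun _ : Fin n => (1 : ℂ)) := by
      ext a b; simp [Matrix.gram_apply]
    rw [this]
    exact Matrix.posSemidef_gram _ _
  | insert i s hi ih =>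
    have : (Matrix.of fun a b : Fin n => ∏ i ∈ insert i s, M i a b) =
        Matrix.hadamard (M i) (Matrix.of fun a b => ∏ i ∈ s, M i a b) := by
      ext a b; simp [Finset.prod_insert hi]
    rw [this]
    exact (hM i).hadamard ih

lemma posSemidef_prod_sub {n : ℕ} (M N : ι → Matrix (Fin n) (Fin n) ℂ)
    (hM : ∀ i, (M i).PosSemidef) (hN : ∀ i, (N i).PosSemidef)
    (h : ∀ i, (N i - M i).PosSemidef) (s : Finset ι) :
    ((Matrix.of fun a b => ∏ i ∈ s, N i a b) -
      (Matrix.of fun a b => ∏ i ∈ s, M i a b)).PosSemidef := by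
  classical
  induction s using Finset.induction_on with
  | empty =>
    simp only [Finset.prod_empty, sub_self]
    exact Matrix.PosSemidef.zero
  | insert i s hi ih =>
    have : ((Matrix.of fun a b => ∏ i ∈ insert i s, N i a b) -
        (Matrix.of fun a b => ∏ i ∈ insert i s, M i a b)) =
        Matrix.hadamard (N i - M i) (Matrix.of fun a b => ∏ i ∈ s, N i a b) +
        Matrix.hadamard (M i) ((Matrix.of fun a b => ∏ i ∈ s, N i a b) -
          (Matrix.of fun a b => ∏ i ∈ s, M i a b)) := by
      ext a b; simp [Finset.prod_insert hi]; ring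
    rw [this]
    exact ((h i).hadamard (posSemidef_prod N hN s)).add ((hM i).hadamard ih)

/-- The (positive semidefinite) inner product on the algebraic tensor product. -/
@[reducible]
def core : PreInnerProductSpace.Core ℂ (AlgTensor H) where
  inner := form
  conj_inner_symm x y := by
    obtain ⟨n, c, v, rfl⟩ := exists_rep x
    obtain ⟨n', d, w, rfl⟩ := exists_rep y
    rw [form_rep, form_rep, map_sum, Finset.sum_comm]
    simp only [map_sum, map_mul, map_prod, Complex.conj_conj]
    rw [Finset.sum_comm]
    conv_rhs => rw [Finset.sum_comm]
    refine Finset.sum_congr rfl fun a _ => Finset.sum_congr rfl fun b _ => ?_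
    simp only [inner_conj_symm]
    ring
  re_inner_nonneg x := by
    obtain ⟨n, c, v, rfl⟩ := exists_rep x
    have := (posSemidef_prod (fun i => Matrix.gram ℂ fun a => v a i)
      (fun i => Matrix.posSemidef_gram _ _) Finset.univ).dotProduct_mulVec_nonneg c
    rw [← form_rep_self] at this
    exact (Complex.nonneg_iff.1 this).1
  add_left := form_add_left
  smul_left x y c := form_smul_left c x y

instance : SeminormedAddCommGroup (AlgTensor H) :=
  @InnerProductSpace.Core.toSeminormedAddCommGroup ℂ (AlgTensor H) _ _ _ core

instance : InnerProductSpace ℂ (AlgTensor H) := InnerProductSpace.ofCore core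

lemma inner_tprod (x y : ∀ i, H i) :
    inner ℂ (tprod x : AlgTensor H) (tprod y) = ∏ i, inner ℂ (x i) (y i) :=
  (form_tprod_left x (tprod y)).trans (functional_tprod x y)

/-- The operator `⊗ Aᵢ` on the algebraic tensor product. -/
def mapLin (A : ∀ i, H i →L[ℂ] H i) : AlgTensor H →ₗ[ℂ] AlgTensor H :=
  PiTensorProduct.map fun i => (A i).toLinearMap

lemma mapLin_tprod (A : ∀ i, H i →L[ℂ] H i) (x : ∀ i, H i) :
    mapLin A (tprod x) = tprod fun i => A i (x i) :=
  PiTensorProduct.map_tprod _ _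

lemma posSemidef_gram_sub {E : Type*} [NormedAddCommGroup E] [InnerProductSpace ℂ E]
    (A : E →L[ℂ] E) {n : ℕ} (v : Fin n → E) :
    (((‖A‖ ^ 2 : ℝ) : ℂ) • Matrix.gram ℂ v - Matrix.gram ℂ fun a => A (v a)).PosSemidef := by
  have h0 : (((‖A‖ ^ 2 : ℝ) : ℂ) • Matrix.gram ℂ v).PosSemidef :=
    (Matrix.posSemidef_gram ℂ v).smul (by exact_mod_cast sq_nonneg ‖A‖)
  refine .of_dotProduct_mulVec_nonneg
    (h0.isHermitian.sub (Matrix.isHermitian_gram _ _)) fun c => ?_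
  rw [Matrix.sub_mulVec, Matrix.smul_mulVec, dotProduct_sub, dotProduct_smul,
    Matrix.star_dotProduct_gram_mulVec, Matrix.star_dotProduct_gram_mulVec]
  have h1 : ∑ a, c a • A (v a) = A (∑ a, c a • v a) := by simp
  rw [h1, inner_self_eq_norm_sq_to_K, inner_self_eq_norm_sq_to_K, smul_eq_mul]
  have h2 : ‖A (∑ a, c a • v a)‖ ^ 2 ≤ ‖A‖ ^ 2 * ‖∑ a, c a • v a‖ ^ 2 := by
    rw [← mul_pow]
    exact pow_le_pow_left₀ (norm_nonneg _) (A.le_opNorm _) 2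
  have h3 : (0 : ℂ) ≤ ((‖A‖ ^ 2 * ‖∑ a, c a • v a‖ ^ 2 - ‖A (∑ a, c a • v a)‖ ^ 2 : ℝ) : ℂ) := by
    exact_mod_cast sub_nonneg.2 h2
  simpa using h3

lemma norm_mapLin_le (A : ∀ i, H i →L[ℂ] H i) (x : AlgTensor H) :
    ‖mapLin A x‖ ≤ (∏ i, ‖A i‖) * ‖x‖ := by
  obtain ⟨n, c, v, rfl⟩ := exists_rep x
  have hmap : mapLin A (∑ a, c a • tprod (v a)) = ∑ a, c a • tprod fun i => A i (v a i) := by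
    simp [mapLin_tprod]
  rw [hmap]
  have key := (posSemidef_prod_sub (fun i => Matrix.gram ℂ fun a => A i (v a i))
    (fun i => ((‖A i‖ ^ 2 : ℝ) : ℂ) • Matrix.gram ℂ fun a => v a i)
    (fun i => Matrix.posSemidef_gram _ _)
    (fun i => (Matrix.posSemidef_gram ℂ _).smul (by exact_mod_cast sq_nonneg ‖A i‖))
    (fun i => posSemidef_gram_sub (A i) fun a => v a i) Finset.univ).dotProduct_mulVec_nonneg c
  have hN : (Matrix.of fun a b => ∏ i, (((‖A i‖ ^ 2 : ℝ) : ℂ) • Matrix.gram ℂ fun a => v a i) a b)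
      = (((∏ i, ‖A i‖) ^ 2 : ℝ) : ℂ) •
        (Matrix.of fun a b => ∏ i, (Matrix.gram ℂ fun a => v a i) a b) := by
    ext a b
    simp [Finset.prod_mul_distrib, Finset.prod_pow]
  rw [hN, Matrix.sub_mulVec, Matrix.smul_mulVec, dotProduct_sub, dotProduct_smul,
    ← form_rep_self, ← form_rep_self (v := fun a i => A i (v a i))] at key
  set X : AlgTensor H := ∑ a, c a • tprod (v a) with hX
  set Y : AlgTensor H := ∑ a, c a • tprod (fun i => A i (v a i)) with hY
  have hXX : form X X = ((‖X‖ ^ 2 : ℝ) : ℂ) := by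
    have := inner_self_eq_norm_sq_to_K (𝕜 := ℂ) X
    push_cast; exact this
  have hYY : form Y Y = ((‖Y‖ ^ 2 : ℝ) : ℂ) := by
    have := inner_self_eq_norm_sq_to_K (𝕜 := ℂ) Y
    push_cast; exact this
  rw [hXX, hYY, smul_eq_mul, ← Complex.ofReal_mul, ← Complex.ofReal_sub] at key
  have key' : ‖Y‖ ^ 2 ≤ (∏ i, ‖A i‖) ^ 2 * ‖X‖ ^ 2 := by
    have : 0 ≤ (∏ i, ‖A i‖) ^ 2 * ‖X‖ ^ 2 - ‖Y‖ ^ 2 := by exact_mod_cast key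
    linarith
  rw [← mul_pow] at key'
  exact le_of_sq_le_sq key' (by positivity)

/-- The bounded operator `⊗ Aᵢ` on the algebraic tensor product. -/
def mapCLM (A : ∀ i, H i →L[ℂ] H i) : AlgTensor H →L[ℂ] AlgTensor H :=
  (mapLin A).mkContinuous (∏ i, ‖A i‖) (norm_mapLin_le A)

end AlgTensor

/-- The Hilbert space tensor product `⨂ᵢ H i`: the (Hausdorff) completion of the algebraic tensor
product for the inner product with `⟪⊗ xᵢ, ⊗ yᵢ⟫ = ∏ ⟪xᵢ, yᵢ⟫`. -/
abbrev HilbertTensor : Type _ := UniformSpace.Completion (AlgTensor H)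

namespace HilbertTensor

variable {H}

/-- The elementary tensor `⊗ xᵢ` in the Hilbert space tensor product. -/
def tensor (x : ∀ i, H i) : HilbertTensor H := ((AlgTensor.tprod x : AlgTensor H) : HilbertTensor H)

lemma inner_tensor (x y : ∀ i, H i) :
    inner ℂ (tensor x) (tensor y) = ∏ i, inner ℂ (x i) (y i) := by
  unfold tensor
  rw [UniformSpace.Completion.inner_coe, AlgTensor.inner_tprod]

lemma norm_tensor_eq_one (ξ : ∀ i, H i) (hξ : ∀ i, ‖ξ i‖ = 1) : ‖tensor ξ‖ = 1 := by
  have h := inner_tensor ξ ξ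
  simp only [inner_self_eq_norm_sq_to_K, hξ] at h
  have h' : ‖tensor ξ‖ ^ 2 = 1 := by
    have : ((‖tensor ξ‖ ^ 2 : ℝ) : ℂ) = ((1 : ℝ) : ℂ) := by push_cast; simpa using h
    exact_mod_cast this
  exact (pow_eq_one_iff_of_nonneg (norm_nonneg _) two_ne_zero).1 h'

lemma dense_span_tensor :
    Dense (Submodule.span ℂ (Set.range (tensor (H := H))) : Set (HilbertTensor H)) := by
  have h : Set.range ((↑) : AlgTensor H → HilbertTensor H) ⊆
      (Submodule.span ℂ (Set.range (tensor (H := H))) : Set (HilbertTensor H)) := by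
    rintro _ ⟨x, rfl⟩
    obtain ⟨n, c, v, rfl⟩ := AlgTensor.exists_rep x
    have : ((∑ a, c a • AlgTensor.tprod (v a) : AlgTensor H) : HilbertTensor H) =
        ∑ a, c a • tensor (v a) := by
      change UniformSpace.Completion.toComplL (𝕜 := ℂ) _ = _
      rw [map_sum]
      simp only [map_smul]
      rfl
    rw [this]
    exact Submodule.sum_mem _ fun a _ =>
      Submodule.smul_mem _ _ (Submodule.subset_span ⟨v a, rfl⟩)
  exact UniformSpace.Completion.denseRange_coe.mono h

lemma ext_tensor {S T : HilbertTensor H →L[ℂ] HilbertTensor H}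
    (h : ∀ x, S (tensor x) = T (tensor x)) : S = T :=
  ContinuousLinearMap.ext_on dense_span_tensor (by rintro _ ⟨x, rfl⟩; exact h x)

/-- The bounded operator `A₁ ⊗ ⋯ ⊗ A_N` on the Hilbert space tensor product. -/
def map (A : ∀ i, H i →L[ℂ] H i) : HilbertTensor H →L[ℂ] HilbertTensor H :=
  (AlgTensor.mapCLM A).completion

lemma map_tensor (A : ∀ i, H i →L[ℂ] H i) (x : ∀ i, H i) :
    map A (tensor x) = tensor fun i => A i (x i) := by
  unfold map tensor
  rw [ContinuousLinearMap.completion_apply_coe]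
  exact congrArg _ (AlgTensor.mapLin_tprod A x)

lemma map_mul (A B : ∀ i, H i →L[ℂ] H i) : map (fun i => A i * B i) = map A * map B :=
  ext_tensor fun x => by simp [map_tensor]

lemma map_star [∀ i, CompleteSpace (H i)] (A : ∀ i, H i →L[ℂ] H i) :
    map (fun i => star (A i)) = star (map A) := by
  refine ext_tensor fun x => ?_
  refine dense_span_tensor.eq_of_inner_left (𝕜 := ℂ) fun y hy => ?_
  induction hy using Submodule.span_induction with
  | mem y hy =>
    obtain ⟨y, rfl⟩ := hy
    rw [ContinuousLinearMap.star_eq_adjoint, ContinuousLinearMap.adjoint_inner_left, map_tensor,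
      map_tensor, inner_tensor, inner_tensor]
    simp [ContinuousLinearMap.star_eq_adjoint, ContinuousLinearMap.adjoint_inner_left]
  | zero => simp
  | add y z _ _ hy hz => rw [inner_add_right, inner_add_right, hy, hz]
  | smul c y _ hy => rw [inner_smul_right, inner_smul_right, hy]

lemma tensor_update_add [DecidableEq ι] (x : ∀ i, H i) (i : ι) (u v : H i) :
    tensor (Function.update x i (u + v)) =
      tensor (Function.update x i u) + tensor (Function.update x i v) := by
  unfold tensor
  rw [MultilinearMap.map_update_add, UniformSpace.Completion.coe_add]

lemma tensor_update_smul [DecidableEq ι] (x : ∀ i, H i) (i : ι) (c : ℂ) (u : H i) :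
    tensor (Function.update x i (c • u)) = c • tensor (Function.update x i u) := by
  unfold tensor
  rw [MultilinearMap.map_update_smul, UniformSpace.Completion.coe_smul]

end HilbertTensor

/-! ## The operator model -/

section Model

variable {H} (G : Digraph ι) (ξ : ∀ i, H i)

open Classical in
/-- The tensor factors of `π_i(A)`: the `i`-th one is `A`, and for `j ≠ i` the `j`-th one is
the identity if `(i, j)` is an edge of `G`, and the projection onto `ξ j` otherwise. -/
def repFactor (i : ι) (A : H i →L[ℂ] H i) : ∀ j, H j →L[ℂ] H j :=
  Function.update (fun j => if G.Adj i j then 1 else projOnto (ξ j)) i A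

open Classical in
lemma map_repFactor_tensor (i : ι) (A : H i →L[ℂ] H i) (x : ∀ j, H j) :
    HilbertTensor.map (repFactor G ξ i A) (HilbertTensor.tensor x) =
      HilbertTensor.tensor (Function.update
        (fun j => (if G.Adj i j then 1 else projOnto (ξ j) : H j →L[ℂ] H j) (x j)) i (A (x i))) := by
  rw [HilbertTensor.map_tensor]
  congr 1
  funext j
  unfold repFactor
  by_cases h : j = i
  · subst h; simp
  · rw [Function.update_of_ne h, Function.update_of_ne h]

lemma projOnto_mul_self {K : Type*} [NormedAddCommGroup K] [InnerProductSpace ℂ K] (ξ : K)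
    (hξ : ‖ξ‖ = 1) : projOnto ξ * projOnto ξ = projOnto ξ := by
  ext x
  simp [projOnto, inner_self_eq_norm_sq_to_K, hξ]

lemma star_projOnto {K : Type*} [NormedAddCommGroup K] [InnerProductSpace ℂ K] [CompleteSpace K]
    (ξ : K) : star (projOnto ξ) = projOnto ξ := by
  rw [ContinuousLinearMap.star_eq_adjoint]
  symm
  rw [ContinuousLinearMap.eq_adjoint_iff]
  intro x y
  simp [projOnto, inner_smul_left, inner_smul_right, mul_comm]

variable [∀ i, CompleteSpace (H i)]

/-- The `*`-homomorphism `π_i : B(H i) → B(H)`, `π_i(A) = P_{i,1} ⊗ ⋯ ⊗ A ⊗ ⋯ ⊗ P_{i,N}` with `A`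
at the `i`-th place, where `H` is the Hilbert space tensor product. -/
def tensorRep (hξ : ∀ i, ‖ξ i‖ = 1) (i : ι) :
    (H i →L[ℂ] H i) →⋆ₙₐ[ℂ] (HilbertTensor H →L[ℂ] HilbertTensor H) where
  toFun A := HilbertTensor.map (repFactor G ξ i A)
  map_smul' c A := by
    classical
    refine HilbertTensor.ext_tensor fun x => ?_
    rw [smul_apply, map_repFactor_tensor, map_repFactor_tensor,
      smul_apply, HilbertTensor.tensor_update_smul]
    rfl
  map_zero' := by
    classical
    refine HilbertTensor.ext_tensor fun x => ?_
    rw [map_repFactor_tensor, zero_apply, zero_apply]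
    have := HilbertTensor.tensor_update_smul
      (fun j => (if G.Adj i j then 1 else projOnto (ξ j) : H j →L[ℂ] H j) (x j)) i 0 0
    rwa [zero_smul, zero_smul] at this
  map_add' A B := by
    classical
    refine HilbertTensor.ext_tensor fun x => ?_
    rw [add_apply, map_repFactor_tensor, map_repFactor_tensor,
      map_repFactor_tensor, add_apply, HilbertTensor.tensor_update_add]
  map_mul' A B := by
    classical
    rw [← HilbertTensor.map_mul]
    congr 1
    funext j
    unfold repFactor
    by_cases h : j = i
    · subst h; simp
    · rw [Function.update_of_ne h, Function.update_of_ne h, Function.update_of_ne h]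
      split_ifs
      · simp
      · rw [projOnto_mul_self _ (hξ j)]
  map_star' A := by
    classical
    rw [← HilbertTensor.map_star]
    congr 1
    funext j
    unfold repFactor
    by_cases h : j = i
    · subst h; simp
    · rw [Function.update_of_ne h, Function.update_of_ne h]
      split_ifs
      · simp
      · rw [star_projOnto]

/-- The vector state `φ(T) = ⟨T ξ, ξ⟩` on `B(H)` for the unit vector `ξ = ⊗ ξᵢ`. -/
def tensorState (hξ : ∀ i, ‖ξ i‖ = 1) : NCState (HilbertTensor H →L[ℂ] HilbertTensor H) :=
  vectorState (HilbertTensor.tensor ξ) (HilbertTensor.norm_tensor_eq_one ξ hξ)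

/-- The `*`-subalgebra `π_i(B(H i))` of `B(H)`. -/
def repAlgebra (hξ : ∀ i, ‖ξ i‖ = 1) (i : ι) :
    NonUnitalStarSubalgebra ℂ (HilbertTensor H →L[ℂ] HilbertTensor H) :=
  NonUnitalStarAlgHom.range (tensorRep G ξ hξ i)

end Model

end Tensor

end

open HilbertTensor in
lemma HilbertTensor.list_prod_map {ι : Type*} [Fintype ι] {H : ι → Type*}
    [∀ i, NormedAddCommGroup (H i)] [∀ i, InnerProductSpace ℂ (H i)] {m : ℕ}
    (F : Fin m → ∀ i, H i →L[ℂ] H i) :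
    (List.ofFn fun p => map (F p)).prod = map fun i => (List.ofFn fun p => F p i).prod := by
  induction m with
  | zero =>
    simp only [List.ofFn_zero, List.prod_nil]
    exact ext_tensor fun x => by simp [map_tensor]
  | succ m ih =>
    simp only [List.ofFn_succ, List.prod_cons]
    rw [ih, ← map_mul]

lemma tensorState_map {ι : Type*} [Fintype ι] {H : ι → Type*}
    [∀ i, NormedAddCommGroup (H i)] [∀ i, InnerProductSpace ℂ (H i)]
    (ξ : ∀ i, H i) (hξ : ∀ i, ‖ξ i‖ = 1) (C : ∀ i, H i →L[ℂ] H i) :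
    tensorState ξ hξ (HilbertTensor.map C) = ∏ i, inner ℂ (ξ i) (C i (ξ i)) := by
  change inner ℂ (HilbertTensor.tensor ξ) (HilbertTensor.map C (HilbertTensor.tensor ξ)) = _
  rw [HilbertTensor.map_tensor, HilbertTensor.inner_tensor]

/-- If the triple product of bounded operators reduces in every tensor factor, with a scalar
appearing only in the `j`-th one, then it reduces on the tensor product. -/
lemma HilbertTensor.map_mul_map_mul_map {ι : Type*} [Fintype ι] {H : ι → Type*}
    [∀ i, NormedAddCommGroup (H i)] [∀ i, InnerProductSpace ℂ (H i)]
    (f g h : ∀ i, H i →L[ℂ] H i) (j : ι) (c : ℂ)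
    (hj : f j * g j * h j = c • (f j * h j))
    (hne : ∀ l, l ≠ j → f l * g l * h l = f l * h l) :
    map f * map g * map h = c • (map f * map h) := by
  classical
  rw [← map_mul, ← map_mul, ← map_mul]
  refine ext_tensor fun x => ?_
  rw [smul_apply, map_tensor, map_tensor]
  have h1 := tensor_update_smul (fun l => (f l * h l) (x l)) j c ((f j * h j) (x j))
  rw [Function.update_eq_self j (fun l => (f l * h l) (x l))] at h1
  rw [← h1]
  congr 1
  funext l
  by_cases hl : l = j
  · subst hl
    rw [Function.update_self, hj, smul_apply]
  · rw [Function.update_of_ne hl, hne l hl]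

section Projection

variable {K : Type*} [NormedAddCommGroup K] [InnerProductSpace ℂ K] {ξ : K}

lemma projOnto_mul_mul_projOnto (ξ : K) (B : K →L[ℂ] K) :
    projOnto ξ * B * projOnto ξ = (inner ℂ ξ (B ξ) : ℂ) • projOnto ξ := by
  ext x
  simp [projOnto, smul_smul, mul_comm]

lemma projOnto_apply_self (hξ : ‖ξ‖ = 1) : projOnto ξ ξ = ξ := by
  simp [projOnto, inner_self_eq_norm_sq_to_K, hξ]

lemma inner_projOnto_apply (hξ : ‖ξ‖ = 1) (x : K) :
    inner ℂ ξ (projOnto ξ x) = (inner ℂ ξ x : ℂ) := by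
  simp [projOnto, inner_self_eq_norm_sq_to_K, hξ]

lemma list_prod_apply_eq_self (hξ : ‖ξ‖ = 1) {m : ℕ} (f : Fin m → K →L[ℂ] K)
    (hf : ∀ p, f p = 1 ∨ f p = projOnto ξ) : (List.ofFn f).prod ξ = ξ := by
  induction m with
  | zero => simp
  | succ m ih =>
    rw [List.ofFn_succ, List.prod_cons, mul_apply_eq_comp, ih _ fun p => hf p.succ]
    rcases hf 0 with h | h <;> simp [h, projOnto_apply_self hξ]

/-- The vector state factorizes on words in which every letter is trivial (the identity or the
projection), or is followed by the projection, or is followed by trivial letters only. -/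
lemma inner_list_prod_apply (hξ : ‖ξ‖ = 1) {m : ℕ} (f : Fin m → K →L[ℂ] K)
    (hf : ∀ p, (f p = 1 ∨ f p = projOnto ξ) ∨
      (∃ q : Fin m, (p : ℕ) + 1 = q ∧ f q = projOnto ξ) ∨
      ∀ q, p < q → f q = 1 ∨ f q = projOnto ξ) :
    inner ℂ ξ ((List.ofFn f).prod ξ) = ∏ p, (inner ℂ ξ (f p ξ) : ℂ) := by
  induction m with
  | zero => simp [inner_self_eq_norm_sq_to_K, hξ]
  | succ m ih =>
    have hself : (inner ℂ ξ ξ : ℂ) = 1 := by simp [inner_self_eq_norm_sq_to_K, hξ]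
    have ih' := ih (fun p => f p.succ) fun p => by
      rcases hf p.succ with h | ⟨q, hq, h⟩ | h
      · exact .inl h
      · obtain ⟨q, rfl⟩ := Fin.exists_succ_eq.2 (show q ≠ 0 by rintro rfl; simp at hq)
        exact .inr (.inl ⟨q, by simpa using hq, h⟩)
      · exact .inr (.inr fun q hq => h q.succ (Fin.succ_lt_succ_iff.2 hq))
    rw [Fin.prod_univ_succ, ← ih', List.ofFn_succ, List.prod_cons, mul_apply_eq_comp]
    rcases hf 0 with (h | h) | ⟨q, hq, h⟩ | h
    · rw [h, one_apply_eq_self, one_apply_eq_self, hself, one_mul]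
    · rw [h, inner_projOnto_apply hξ, inner_projOnto_apply hξ, hself, one_mul]
    · obtain ⟨q, rfl⟩ := Fin.exists_succ_eq.2 (show q ≠ 0 by rintro rfl; simp at hq)
      cases m with
      | zero => exact q.elim0
      | succ m =>
        obtain rfl : q = 0 := by ext; simpa using hq.symm
        rw [List.ofFn_succ, List.prod_cons, mul_apply_eq_comp, h,
          inner_projOnto_apply hξ]
        simp [projOnto, mul_comm]
    · rw [list_prod_apply_eq_self hξ _ fun p => h p.succ (Fin.succ_pos p), hself, mul_one]

end Projection

lemma List.prod_eq_smul_prod_eraseIdx {A : Type*} [Ring A] [Algebra ℂ A] (c : ℂ) (L : List A)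
    (p : ℕ) (hp : p + 2 < L.length)
    (h : L[p] * L[p + 1] * L[p + 2] = c • (L[p] * L[p + 2])) :
    L.prod = c • (L.eraseIdx (p + 1)).prod := by
  induction p generalizing L with
  | zero =>
    match L, hp, h with
    | x :: y :: z :: L, _, h =>
      simp only [List.getElem_cons_zero, List.getElem_cons_succ] at h
      simp only [List.eraseIdx_cons_succ, List.eraseIdx_cons_zero, List.prod_cons, zero_add]
      rw [← mul_assoc, ← mul_assoc, ← mul_assoc, h, smul_mul_assoc]
  | succ p ih =>
    match L, hp, h with
    | x :: L, hp, h =>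
      simp only [List.getElem_cons_succ] at h
      rw [List.eraseIdx_cons_succ, List.prod_cons, List.prod_cons,
        ih L (Nat.lt_of_succ_lt_succ hp) h, mul_smul_comm]

lemma repFactor_self {ι : Type*} {H : ι → Type*} [∀ i, NormedAddCommGroup (H i)]
    [∀ i, InnerProductSpace ℂ (H i)] (G : Digraph ι) (ξ : ∀ i, H i) (i : ι) (A : H i →L[ℂ] H i) :
    repFactor G ξ i A i = A := by
  simp [repFactor]

section Model

variable {ι : Type*} [PartialOrder ι] {H : ι → Type*} [∀ i, NormedAddCommGroup (H i)]
  [∀ i, InnerProductSpace ℂ (H i)] (ξ : ∀ i, H i)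

lemma repFactor_of_lt {i j : ι} (h : j < i) (A : H i →L[ℂ] H i) :
    repFactor (orderDigraph ι) ξ i A j = 1 := by
  classical simp [repFactor, h.ne, orderDigraph, h]

lemma repFactor_of_not_le {i j : ι} (h : ¬ j ≤ i) (A : H i →L[ℂ] H i) :
    repFactor (orderDigraph ι) ξ i A j = projOnto (ξ j) := by
  have h1 : j ≠ i := fun e => h e.le
  have h2 : ¬ j < i := fun e => h e.le
  classical simp [repFactor, h1, orderDigraph, h2]

lemma repFactor_of_ne {i j : ι} (h : j ≠ i) (A : H i →L[ℂ] H i) :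
    repFactor (orderDigraph ι) ξ i A j = 1 ∨
      repFactor (orderDigraph ι) ξ i A j = projOnto (ξ j) := by
  by_cases hj : j < i
  · exact .inl (repFactor_of_lt ξ hj A)
  · exact .inr (repFactor_of_not_le ξ (fun e => hj (e.lt_of_ne h)) A)

lemma tensorState_map_repFactor [Fintype ι] (hξ : ∀ i, ‖ξ i‖ = 1) (i : ι) (A : H i →L[ℂ] H i) :
    tensorState ξ hξ (HilbertTensor.map (repFactor (orderDigraph ι) ξ i A)) =
      inner ℂ (ξ i) (A (ξ i)) := by
  rw [tensorState_map, Finset.prod_eq_single i, repFactor_self _ ξ]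
  · intro j _ hj
    rcases repFactor_of_ne ξ hj A with h | h <;>
      simp [h, projOnto_apply_self (hξ j), inner_self_eq_norm_sq_to_K, hξ]
  · simp

/-- A letter between two neighbours not above it, one of which is strictly below it, is replaced
by a scalar. -/
lemma map_repFactor_mul_mul [Fintype ι] (hξ : ∀ i, ‖ξ i‖ = 1) {p k q : ι}
    (h : p < k ∧ q < k ∨ Incomp p k ∧ q < k ∨ p < k ∧ Incomp k q)
    (A : H p →L[ℂ] H p) (B : H k →L[ℂ] H k) (C : H q →L[ℂ] H q) :
    HilbertTensor.map (repFactor (orderDigraph ι) ξ p A) *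
        HilbertTensor.map (repFactor (orderDigraph ι) ξ k B) *
        HilbertTensor.map (repFactor (orderDigraph ι) ξ q C) =
      (inner ℂ (ξ k) (B (ξ k)) : ℂ) •
        (HilbertTensor.map (repFactor (orderDigraph ι) ξ p A) *
          HilbertTensor.map (repFactor (orderDigraph ι) ξ q C)) := by
  have hp : ¬ k ≤ p := by
    rcases h with h | h | h
    exacts [h.1.not_ge, h.1.2, h.1.not_ge]
  have hq : ¬ k ≤ q := by
    rcases h with h | h | h
    exacts [h.2.not_ge, h.2.not_ge, h.2.1]
  refine HilbertTensor.map_mul_map_mul_map _ _ _ k _ ?_ fun l hl => ?_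
  · rw [repFactor_self _ ξ, repFactor_of_not_le ξ hp, repFactor_of_not_le ξ hq,
      projOnto_mul_mul_projOnto, projOnto_mul_self _ (hξ k)]
  · by_cases hlk : l < k
    · rw [repFactor_of_lt ξ hlk, mul_one]
    · have hlk' : ¬ l ≤ k := fun e => hlk (e.lt_of_ne hl)
      rw [repFactor_of_not_le ξ hlk']
      by_cases hpk : p < k
      · rw [repFactor_of_not_le ξ (fun e => hlk (e.trans_lt hpk)), projOnto_mul_self _ (hξ l)]
      · have hqk : q < k := by tauto
        rw [repFactor_of_not_le (i := q) ξ (fun e => hlk (e.trans_lt hqk)), mul_assoc,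
          projOnto_mul_self _ (hξ l)]

lemma bm1_repFactor [Fintype ι] (hξ : ∀ i, ‖ξ i‖ = 1) {m : ℕ} (i : Fin m → ι)
    (B : ∀ k, H (i k) →L[ℂ] H (i k)) :
    BM1 (tensorState ξ hξ) i
      fun k => HilbertTensor.map (repFactor (orderDigraph ι) ξ (i k) (B k)) := by
  rintro ⟨p, hp⟩ ⟨_, hk⟩ ⟨_, hq⟩ rfl rfl h
  rw [tensorState_map_repFactor]
  refine List.prod_eq_smul_prod_eraseIdx _ _ p (by simpa using hq) ?_
  simp only [List.getElem_ofFn]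
  exact map_repFactor_mul_mul ξ hξ h _ _ _

lemma lt_of_consecutive_lt {m : ℕ} (i : Fin m → ι) (l : Fin m)
    (h : ∀ p q : Fin m, (p : ℕ) + 1 = q → l ≤ p → i p < i q) {p q : Fin m} (hlp : l ≤ p)
    (hpq : p < q) : i p < i q := by
  obtain ⟨q, hq⟩ := q
  induction q with
  | zero => exact absurd hpq (by simp [Fin.lt_def])
  | succ q ih =>
    have hpq' : (p : ℕ) ≤ q := Nat.lt_succ_iff.1 hpq
    have hstep := h ⟨q, by omega⟩ ⟨q + 1, hq⟩ rfl (hlp.trans hpq')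
    rcases hpq'.eq_or_lt with e | e
    · rwa [show p = ⟨q, by omega⟩ from Fin.ext e]
    · exact (ih (by omega) e).trans hstep

lemma bm2_repFactor [Fintype ι] (hξ : ∀ i, ‖ξ i‖ = 1) {m : ℕ} (i : Fin m → ι)
    (B : ∀ k, H (i k) →L[ℂ] H (i k)) :
    BM2 (tensorState ξ hξ) i
      fun k => HilbertTensor.map (repFactor (orderDigraph ι) ξ (i k) (B k)) := by
  intro k l _ hdec hinc hasc
  simp only [tensorState_map]
  rw [HilbertTensor.list_prod_map, tensorState_map, Finset.prod_comm]
  refine Finset.prod_congr rfl fun j _ => inner_list_prod_apply (hξ j) _ fun p => ?_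
  by_cases hj : j = i p
  · subst hj
    refine .inr ?_
    by_cases hlp : l ≤ p
    · exact .inr fun q hq => .inl (repFactor_of_lt ξ (lt_of_consecutive_lt i l hasc hlp hq) _)
    · have hpl : (p : ℕ) < l := not_le.1 hlp
      let q : Fin m := ⟨p + 1, by omega⟩
      refine .inl ⟨q, rfl, repFactor_of_not_le ξ ?_ _⟩
      by_cases hkp : k ≤ p
      · exact (hinc p q rfl hkp (Nat.succ_le_of_lt hpl)).1
      · exact (hdec p q rfl (Nat.succ_le_of_lt (not_le.1 hkp))).not_ge
  · exact .inl (repFactor_of_ne ξ hj _)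

end Model

theorem mainTheorem8 {ι : Type*} [Fintype ι] [PartialOrder ι] {H : ι → Type*}
    [∀ i, NormedAddCommGroup (H i)] [∀ i, InnerProductSpace ℂ (H i)] [∀ i, CompleteSpace (H i)]
    (ξ : ∀ i, H i) (hξ : ∀ i, ‖ξ i‖ = 1) :
    BMIndependent (tensorState ξ hξ)
      (fun i => (repAlgebra (orderDigraph ι) ξ hξ i).toNonUnitalSubalgebra) := by
  intro m i a ha _
  choose B hB using fun k => (NonUnitalStarAlgHom.mem_range _).1 (ha k)
  obtain rfl : a = fun k => HilbertTensor.map (repFactor (orderDigraph ι) ξ (i k) (B k)) :=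
    funext fun k => (hB k).symm
  exact ⟨bm1_repFactor ξ hξ i B, bm2_repFactor ξ hξ i B⟩
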